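/- Let $V$ be a finite-dimensional vector space over $\mathbb R$ or over $\mathbb Q_p$ ($p$ prime), with its canonical Hausdorff vector space topology. A *contraction* of $V$ is a continuous automorphism $T$ of the topological group $V$ such that $T^n x \to 0$ for all $x \in V$. For a Borel probability measure $\mu$ on $V$ and a continuous automorphism $T$ of $V$, let $T(\mu)(B) = \mu(T^{-1}(B))$ for every Borel set $B$, and let $*$ denote convolution. The measure $\mu$ is *full* if it is not supported on a coset $x + W$ of a proper linear subspace $W \subsetneq V$, and *autophage* if $\mu = T(\mu) * S(\mu)$ for some contractions $T, S$ of $V$ with $TS = ST$. Let $T_1, \dots, T_m$ be contractions of $V$ such that $T_i T_j = T_j T_i$ for all $1 \le i, j \le m$, and let $\mu$ be a full Borel probability measure on $V$ such that $\mu = T_1(\mu) * T_2(\mu) * \cdots * T_m(\mu)$. Then $\mu$ is absolutely continuous with respect to Haar measure on $V$, with a bounded continuous density. In particular, every full autophage probability measure on $V$ is absolutely continuous with respect to Haar measure, with a bounded continuous density. -/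

import Mathlib

open MeasureTheory Filter Topology
open scoped BoundedContinuousFunction

/-- A continuous automorphism `T` of a topological (additive) group is a contraction if
`T^n x → 0` for every `x`. -/
def IsContraction {G : Type*} [AddGroup G] [TopologicalSpace G] (T : G ≃ₜ+ G) : Prop :=
  ∀ x : G, Tendsto (fun n : ℕ => T^[n] x) atTop (𝓝 0)

/-- The convolution product `T_1(μ) * (T_2(μ) * (⋯ * T_m(μ)))` of the images of `μ` under
`T_1, …, T_m`; the empty product is the Dirac measure at `0`. -/
noncomputable def convImages {G : Type*} [AddGroup G] [TopologicalSpace G] [MeasurableSpace G]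
    {m : ℕ} (T : Fin m → G ≃ₜ+ G) (μ : Measure G) : Measure G :=
  (List.ofFn fun i => μ.map (T i)).foldr Measure.conv (Measure.dirac 0)

/-- `μ` is autophage if `μ = T(μ) * S(μ)` for some commuting contractions `T`, `S`. -/
def IsAutophage {G : Type*} [AddGroup G] [TopologicalSpace G] [MeasurableSpace G]
    (μ : Measure G) : Prop :=
  ∃ T S : G ≃ₜ+ G, IsContraction T ∧ IsContraction S ∧ Function.Commute T S ∧
    μ = Measure.conv (μ.map T) (μ.map S)

/-- `μ` is full if it is not supported on a coset `x + W` of a proper linear subspace `W`. -/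
def IsFull (K : Type*) {V : Type*} [Field K] [AddCommGroup V] [Module K V] [MeasurableSpace V]
    (μ : Measure V) : Prop :=
  ∀ W : Submodule K V, W ≠ ⊤ → ∀ x : V, μ {y | y - x ∈ W}ᶜ ≠ 0

/-- `μ` is absolutely continuous with respect to `ν`, with a nonnegative bounded continuous
density. -/
def HasBoundedContinuousDensity {V : Type*} [TopologicalSpace V] [MeasurableSpace V]
    (μ ν : Measure V) : Prop :=
  μ ≪ ν ∧ ∃ f : V →ᵇ ℝ, (∀ x, 0 ≤ f x) ∧ μ = ν.withDensity fun x => ENNReal.ofReal (f x)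

/-!
Fix a nontrivial continuous character `ψ` of the base field `K` and let `φ ξ = ∫ ψ (ξ x) ∂μ` be
the Fourier transform of `μ` on the dual of `V`. The convolution equation becomes the product
formula `φ ξ = ∏ i, φ (ξ ∘ T i)`, whose factors have modulus at most `1`. The functionals with
`‖φ ξ‖ = 1` are those for which `ψ ∘ ξ` is almost everywhere constant; they form a closed subgroup,
stable under every `ξ ↦ ξ ∘ T i`, and it contains no line because `μ` is full. Hence this subgroup
is bounded, so that `‖φ‖ ≤ θ < 1` far from `0`: the orbit of `ξ` under a contraction has to visit a
fixed annulus, and `‖φ‖` does not decrease along the orbit. With two factors, `‖φ‖` is squared each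
time `‖ξ‖` grows by a fixed factor, so `φ` decays like `θ ^ 2 ^ d` at distance `t ^ d`, which beats
the exponential growth of volumes; a single factor forces `φ = 1` and hence `V = 0`. In both cases
`φ` is integrable, and Fourier inversion gives the density.
-/

universe u

/-! ### The Fourier transform with respect to a character -/

lemma continuous_coe_addChar_apply {K V : Type*} [NontriviallyNormedField K] [AddCommGroup V]
    [Module K V] [TopologicalSpace V] {ψ : AddChar K Circle} (hψ : Continuous ψ) (ξ : V →L[K] K) :
    Continuous fun x => (ψ (ξ x) : ℂ) :=
  continuous_subtype_val.comp (hψ.comp ξ.continuous)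

section AddCharFun

variable {K V W : Type*} [NontriviallyNormedField K]
  [AddCommGroup V] [Module K V] [TopologicalSpace V] [MeasurableSpace V]
  [AddCommGroup W] [Module K W] [TopologicalSpace W] [MeasurableSpace W] [BorelSpace W]
  {ψ : AddChar K Circle} {μ ρ : Measure V}

/-- The Fourier transform of `μ`, as a function on the dual of `V` and with respect to the
additive character `ψ` of the base field. -/
noncomputable def addCharFun (ψ : AddChar K Circle) (μ : Measure V) (ξ : V →L[K] K) : ℂ :=
  ∫ x, (ψ (ξ x) : ℂ) ∂μ

lemma norm_addCharFun_le_one [IsProbabilityMeasure μ] (ξ : V →L[K] K) :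
    ‖addCharFun ψ μ ξ‖ ≤ 1 := by
  simpa [addCharFun] using norm_integral_le_of_norm_le_const (μ := μ) (C := 1)
    (ae_of_all _ fun x => (Circle.norm_coe (ψ (ξ x))).le)

lemma addCharFun_zero [IsProbabilityMeasure μ] : addCharFun ψ μ 0 = 1 := by
  simp [addCharFun]

lemma addCharFun_map [BorelSpace V] (hψ : Continuous ψ) (A : V →L[K] W) (ξ : W →L[K] K) :
    addCharFun ψ (μ.map A) ξ = addCharFun ψ μ (ξ.comp A) :=
  integral_map A.continuous.measurable.aemeasurable
    (continuous_coe_addChar_apply hψ ξ).aestronglyMeasurable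

lemma addCharFun_dirac_zero [BorelSpace V] (hψ : Continuous ψ) (ξ : V →L[K] K) :
    addCharFun ψ (Measure.dirac 0) ξ = 1 := by
  rw [addCharFun, integral_dirac' _ _ (continuous_coe_addChar_apply hψ ξ).stronglyMeasurable]
  simp

lemma addCharFun_conv [BorelSpace V] [MeasurableAdd₂ V] [IsFiniteMeasure μ] [IsFiniteMeasure ρ]
    (hψ : Continuous ψ) (ξ : V →L[K] K) :
    addCharFun ψ (μ.conv ρ) ξ = addCharFun ψ μ ξ * addCharFun ψ ρ ξ := by
  have hint : Integrable (fun x => (ψ (ξ x) : ℂ)) (μ.conv ρ) :=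
    .of_bound (continuous_coe_addChar_apply hψ ξ).aestronglyMeasurable 1
      (ae_of_all _ fun x => (Circle.norm_coe _).le)
  simp only [addCharFun, integral_conv hint, map_add, AddChar.map_add_eq_mul, Circle.coe_mul,
    integral_const_mul, integral_mul_const]

end AddCharFun

lemma convImages_succ {G : Type*} [AddGroup G] [TopologicalSpace G] [MeasurableSpace G] {m : ℕ}
    (T : Fin (m + 1) → G ≃ₜ+ G) (μ : Measure G) :
    convImages T μ = (μ.map (T 0)).conv (convImages (fun i => T i.succ) μ) := by
  simp [convImages, List.ofFn_succ]

instance isFiniteMeasure_convImages {G : Type*} [AddGroup G] [TopologicalSpace G]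
    [MeasurableSpace G] {m : ℕ} (T : Fin m → G ≃ₜ+ G) (μ : Measure G) [IsFiniteMeasure μ] :
    IsFiniteMeasure (convImages T μ) := by
  induction m with
  | zero => exact inferInstanceAs (IsFiniteMeasure (Measure.dirac 0))
  | succ m ih => rw [convImages_succ]; have := ih fun i => T i.succ; infer_instance

lemma addCharFun_convImages {K V : Type*} [NontriviallyNormedField K] [AddCommGroup V]
    [Module K V] [TopologicalSpace V] [MeasurableSpace V] [BorelSpace V] [MeasurableAdd₂ V]
    {ψ : AddChar K Circle} (hψ : Continuous ψ) {μ : Measure V} [IsFiniteMeasure μ] {m : ℕ}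
    (A : Fin m → V ≃L[K] V) (ξ : V →L[K] K) :
    addCharFun ψ (convImages (fun i => (A i).toContinuousAddEquiv) μ) ξ =
      ∏ i, addCharFun ψ μ (ξ.comp (A i : V →L[K] V)) := by
  induction m with
  | zero => simpa [convImages] using addCharFun_dirac_zero hψ ξ
  | succ m ih =>
    rw [convImages_succ, addCharFun_conv hψ, ih fun i => A i.succ, Fin.prod_univ_succ]
    congr 1
    exact addCharFun_map hψ (A 0 : V →L[K] V) ξ

/-- The functionals `ξ` for which `ψ ∘ ξ` is almost everywhere constant. -/
def phaseSubgroup {K V : Type*} [NontriviallyNormedField K] [AddCommGroup V] [Module K V]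
    [TopologicalSpace V] [MeasurableSpace V] (ψ : AddChar K Circle) (μ : Measure V) :
    AddSubgroup (V →L[K] K) where
  carrier := {ξ | EventuallyConst (fun x => ψ (ξ x)) (ae μ)}
  zero_mem' := by simp
  add_mem' {ξ η} hξ hη := by simpa [AddChar.map_add_eq_mul] using hξ.comp₂ (· * ·) hη
  neg_mem' {ξ} hξ := by
    simpa [AddChar.map_neg_eq_inv, Function.comp_def] using hξ.comp (·⁻¹)

section PhaseSubgroup

variable {K V : Type*} [NontriviallyNormedField K] [AddCommGroup V] [Module K V]
  [TopologicalSpace V] [MeasurableSpace V] {ψ : AddChar K Circle} {μ : Measure V}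
  [IsProbabilityMeasure μ]

lemma mem_phaseSubgroup_iff {ξ : V →L[K] K} :
    ξ ∈ phaseSubgroup ψ μ ↔ ‖addCharFun ψ μ ξ‖ = 1 := by
  change EventuallyConst (fun x => ψ (ξ x)) (ae μ) ↔ _
  refine ⟨fun h => ?_, fun h => ?_⟩
  · obtain ⟨z, hz⟩ := eventuallyConst_iff_exists_eventuallyEq.1 h
    have hz' : (fun x => (ψ (ξ x) : ℂ)) =ᵐ[μ] fun _ => (z : ℂ) := hz.fun_comp _
    simpa [addCharFun, integral_congr_ae hz'] using Circle.norm_coe z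
  · obtain h1 | h1 := ae_eq_const_or_norm_integral_lt_of_norm_le_const (μ := μ) (C := 1)
      (f := fun x => (ψ (ξ x) : ℂ)) (ae_of_all _ fun x => (Circle.norm_coe _).le)
    · obtain ⟨x₀, hx₀⟩ := h1.exists
      refine eventuallyConst_iff_exists_eventuallyEq.2 ⟨ψ (ξ x₀), ?_⟩
      filter_upwards [h1] with x hx using Circle.ext (hx.trans hx₀.symm)
    · exact absurd h (by simpa [addCharFun] using h1.ne)

lemma comp_mem_phaseSubgroup {ι : Type*} [Fintype ι] {T : ι → V ≃L[K] V}
    (hprod : ∀ ξ, addCharFun ψ μ ξ = ∏ i, addCharFun ψ μ (ξ.comp (T i : V →L[K] V)))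
    {ξ : V →L[K] K} (hξ : ξ ∈ phaseSubgroup ψ μ) (i : ι) :
    ξ.comp (T i : V →L[K] V) ∈ phaseSubgroup ψ μ := by
  classical
  refine mem_phaseSubgroup_iff.2 (le_antisymm (norm_addCharFun_le_one _) ?_)
  calc 1 = ∏ j, ‖addCharFun ψ μ (ξ.comp (T j : V →L[K] V))‖ := by
        rw [← norm_prod, ← hprod, mem_phaseSubgroup_iff.1 hξ]
    _ ≤ ‖addCharFun ψ μ (ξ.comp (T i : V →L[K] V))‖ := by
        rw [← Finset.mul_prod_erase _ _ (Finset.mem_univ i)]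
        exact mul_le_of_le_one_right (norm_nonneg _)
          (Finset.prod_le_one (fun _ _ => norm_nonneg _) fun _ _ => norm_addCharFun_le_one _)

lemma eq_zero_of_forall_smul_mem_phaseSubgroup [SecondCountableTopology K] (hψ : Continuous ψ)
    (hψ1 : ψ ≠ 1) (hμ : IsFull K μ) {η : V →L[K] K}
    (hη : ∀ t : K, t • η ∈ phaseSubgroup ψ μ) : η = 0 := by
  obtain ⟨D, hDc, hDd⟩ := TopologicalSpace.exists_countable_dense K
  choose c hc using fun t => eventuallyConst_iff_exists_eventuallyEq.1 (hη t)
  have hae : ∀ᵐ x ∂μ, ∀ t ∈ D, ψ (t * η x) = c t := (ae_ball_iff hDc).2 fun t _ => hc t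
  obtain ⟨x₀, hx₀⟩ := hae.exists
  have hconst : ∀ᵐ x ∂μ, η x = η x₀ := by
    filter_upwards [hae] with x hx
    by_contra hne
    have hs : η x - η x₀ ≠ 0 := sub_ne_zero.2 hne
    have htriv : (fun t => ψ (t * (η x - η x₀))) = fun _ => 1 :=
      Continuous.ext_on hDd (hψ.comp (by fun_prop)) continuous_const fun t ht => by
        simp only [mul_sub, AddChar.map_sub_eq_div, hx t ht, hx₀ t ht, div_self']
    refine hψ1 (AddChar.eq_one_iff.2 fun a => ?_)
    simpa [hs] using congrFun htriv (a / (η x - η x₀))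
  by_contra hne
  refine hμ η.ker (mt LinearMap.ker_eq_top.1 fun h => hne ?_) x₀ ?_
  · exact ContinuousLinearMap.coe_injective h
  · convert ae_iff.1 hconst using 2
    ext x
    simp [sub_eq_zero]

end PhaseSubgroup

section Normed

variable {K V : Type*} [NontriviallyNormedField K] [NormedAddCommGroup V] [NormedSpace K V]
  [MeasurableSpace V] [BorelSpace V] {ψ : AddChar K Circle}
  {μ : Measure V} [IsProbabilityMeasure μ]

lemma continuous_addCharFun (hψ : Continuous ψ) : Continuous (addCharFun ψ μ) := by
  refine continuous_of_dominated (bound := fun _ => 1)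
    (fun ξ => (continuous_coe_addChar_apply hψ ξ).aestronglyMeasurable)
    (fun ξ => ae_of_all _ fun x => (Circle.norm_coe _).le) (by simp) ?_
  exact ae_of_all _ fun x => continuous_subtype_val.comp (hψ.comp (by fun_prop))

lemma isClosed_phaseSubgroup (hψ : Continuous ψ) :
    IsClosed (phaseSubgroup ψ μ : Set (V →L[K] K)) := by
  have heq : (phaseSubgroup ψ μ : Set (V →L[K] K)) = {ξ | ‖addCharFun ψ μ ξ‖ = 1} :=
    Set.ext fun ξ => mem_phaseSubgroup_iff
  rw [heq]
  exact isClosed_eq (continuous_addCharFun hψ).norm continuous_const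

end Normed

/-! ### Integrability from a product formula -/

lemma exists_le_mul_norm_iterate_le {E : Type*} [SeminormedAddCommGroup E] {A : E → E} {C r : ℝ}
    (hA : ∀ x, ‖x‖ ≤ C * ‖A x‖) (hr : 0 < r) {x : E}
    (hAx : Tendsto (fun n : ℕ => A^[n] x) atTop (𝓝 0)) (hx : r ≤ C * ‖x‖) :
    ∃ n : ℕ, r ≤ C * ‖A^[n] x‖ ∧ ‖A^[n] x‖ ≤ r := by
  classical
  have hex : ∃ n : ℕ, ‖A^[n] x‖ ≤ r :=
    ((by simpa using hAx.norm : Tendsto _ _ (𝓝 (0 : ℝ))).eventually (ge_mem_nhds hr)).exists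
  refine ⟨Nat.find hex, ?_, Nat.find_spec hex⟩
  rcases hn : Nat.find hex with _ | k
  · simpa using hx
  · have hk : r < ‖A^[k] x‖ := not_le.1 (Nat.find_min hex (by lia))
    rw [Function.iterate_succ_apply']
    exact hk.le.trans (hA _)

section Decay

variable {E : Type*} [NormedAddCommGroup E] {Φ : E → ℝ} {A B : E → E} {C : ℝ}

/-- The orbit of a point far from `0` under the contraction `A` cannot jump over a wide annulus
around the set where `Φ = 1`, and `Φ` only increases along the orbit. -/
lemma exists_lt_one_forall_le_of_tendsto_iterate [ProperSpace E] (hΦ : Continuous Φ)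
    (h1 : ∀ x, Φ x ≤ 1) (hb : Bornology.IsBounded {x | Φ x = 1}) (hC : 0 < C)
    (hA : ∀ x, ‖x‖ ≤ C * ‖A x‖) (hAn : ∀ x, Tendsto (fun n : ℕ => A^[n] x) atTop (𝓝 0))
    (hΦA : ∀ x, Φ x ≤ Φ (A x)) :
    ∃ R > 0, ∃ θ > 0, θ < 1 ∧ ∀ x, R ≤ ‖x‖ → Φ x ≤ θ := by
  obtain ⟨R, hR, hlt⟩ : ∃ R > 0, ∀ x, R ≤ ‖x‖ → Φ x < 1 := by
    obtain ⟨R, hR, hsub⟩ := hb.subset_ball_lt 0 0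
    refine ⟨R, hR, fun x hx => (h1 x).lt_of_ne fun h => ?_⟩
    exact hx.not_gt (by simpa using hsub h)
  let S : Set E := {x | C * R ≤ C * ‖x‖ ∧ ‖x‖ ≤ C * R}
  have hS : IsCompact S := by
    refine (isCompact_closedBall (0 : E) (C * R)).of_isClosed_subset ?_ fun x hx => by
      simpa using hx.2
    exact (isClosed_le continuous_const (continuous_norm.const_mul C)).inter
      (isClosed_le continuous_norm continuous_const)
  obtain ⟨θ, hθ0, hθ1, hθ⟩ : ∃ θ > 0, θ < 1 ∧ ∀ x ∈ S, Φ x ≤ θ := by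
    obtain he | hne := S.eq_empty_or_nonempty
    · exact ⟨1 / 2, by norm_num, by norm_num, by simp [he]⟩
    · obtain ⟨x, hx, hmax⟩ := hS.exists_isMaxOn hne hΦ.continuousOn
      exact ⟨max (Φ x) (1 / 2), by positivity,
        max_lt (hlt x (le_of_mul_le_mul_left hx.1 hC)) (by norm_num),
        fun y hy => (hmax hy).trans (le_max_left _ _)⟩
  have hmono : ∀ x (n : ℕ), Φ x ≤ Φ (A^[n] x) := fun x n => by
    induction n with
    | zero => rfl
    | succ n ih => rw [Function.iterate_succ_apply']; exact ih.trans (hΦA _)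
  refine ⟨R, hR, θ, hθ0, hθ1, fun x hx => ?_⟩
  obtain ⟨n, hn⟩ := exists_le_mul_norm_iterate_le hA (mul_pos hC hR) (hAn x) (by gcongr)
  exact (hmono x n).trans (hθ _ hn)

lemma le_pow_two_pow_of_le_mul {θ R : ℝ} (h0 : ∀ x, 0 ≤ Φ x) (hC : 0 < C)
    (hA : ∀ x, ‖x‖ ≤ C * ‖A x‖) (hB : ∀ x, ‖x‖ ≤ C * ‖B x‖)
    (hΦ : ∀ x, Φ x ≤ Φ (A x) * Φ (B x)) (hθ : ∀ x, R ≤ ‖x‖ → Φ x ≤ θ) (d : ℕ) (x : E)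
    (hx : C ^ d * R ≤ ‖x‖) : Φ x ≤ θ ^ 2 ^ d := by
  induction d generalizing x with
  | zero => simpa using hθ x (by simpa using hx)
  | succ d ih =>
    have hstep : ∀ y : E, ‖x‖ ≤ C * ‖y‖ → Φ y ≤ θ ^ 2 ^ d := fun y hy =>
      ih y (le_of_mul_le_mul_left (by rw [← mul_assoc, ← pow_succ']; exact hx.trans hy) hC)
    calc Φ x ≤ Φ (A x) * Φ (B x) := hΦ x
      _ ≤ θ ^ 2 ^ d * θ ^ 2 ^ d :=
        mul_le_mul (hstep _ (hA x)) (hstep _ (hB x)) (h0 _) ((h0 _).trans (hstep _ (hA x)))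
      _ = θ ^ 2 ^ (d + 1) := by rw [← pow_add, ← two_mul, ← pow_succ']

end Decay

lemma summable_pow_two_pow_mul_pow {θ c : ℝ} (hθ0 : 0 < θ) (hθ1 : θ < 1) (hc : 0 < c) :
    Summable fun d : ℕ => θ ^ 2 ^ d * c ^ d := by
  refine summable_of_ratio_test_tendsto_lt_one one_pos (.of_forall fun d => by positivity) ?_
  have hlim : Tendsto (fun d : ℕ => θ ^ 2 ^ d * c) atTop (𝓝 0) := by
    simpa using ((tendsto_pow_atTop_nhds_zero_of_lt_one hθ0.le hθ1).comp
      (tendsto_pow_atTop_atTop_of_one_lt one_lt_two)).mul_const c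
  refine hlim.congr fun d => ?_
  rw [Real.norm_of_nonneg (by positivity), Real.norm_of_nonneg (by positivity),
    eq_div_iff (by positivity), pow_succ 2 d, pow_mul]
  ring

section Homothety

variable {K X : Type*} [NontriviallyNormedField K] [NormedAddCommGroup X] [NormedSpace K X]
  [MeasurableSpace X] [BorelSpace X] {ν : Measure X} {t : K}

lemma integral_comp_smul_of_map_eq {F : Type*} [NormedAddCommGroup F] [NormedSpace ℝ F]
    (ht : t ≠ 0) {J : NNReal} (hJ : ν.map (t • ·) = J • ν) (f : X → F) :
    ∫ x, f (t • x) ∂ν = (J : ℝ) • ∫ x, f x ∂ν := by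
  have hm : MeasurableEmbedding fun x : X => t • x :=
    (Homeomorph.smulOfNeZero t ht).measurableEmbedding
  rw [← hm.integral_map, hJ, integral_smul_nnreal_measure]
  rfl

variable [ProperSpace X] [ν.IsAddHaarMeasure]

variable (ν) in
lemma exists_map_smul_eq_smul (ht : t ≠ 0) :
    ∃ J : NNReal, 0 < J ∧ ν.map (t • ·) = J • ν := by
  let e : X ≃L[K] X := ContinuousLinearEquiv.smulLeft (Units.mk0 t ht)
  have : (ν.map e).IsAddHaarMeasure := e.isAddHaarMeasure_map ν
  exact ⟨_, Measure.addHaarScalarFactor_pos_of_isAddHaarMeasure (ν.map e) ν,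
    Measure.isAddLeftInvariant_eq_smul (ν.map e) ν⟩

lemma integrable_comp_smul_of_ne_zero {F : Type*} [NormedAddCommGroup F] (ht : t ≠ 0)
    {f : X → F} (hf : Integrable f ν) : Integrable (fun x => f (t • x)) ν := by
  have hm : MeasurableEmbedding fun x : X => t • x :=
    (Homeomorph.smulOfNeZero t ht).measurableEmbedding
  obtain ⟨J, -, hJ⟩ := exists_map_smul_eq_smul ν ht
  rw [← Function.comp_def, ← hm.integrable_map_iff, hJ]
  exact hf.smul_measure_nnreal

variable (ν) in
lemma exists_measureReal_closedBall_norm_mul (ht : t ≠ 0) :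
    ∃ c > 0, ∀ r, ν.real (Metric.closedBall 0 (‖t‖ * r)) = c * ν.real (Metric.closedBall 0 r) := by
  obtain ⟨J, hJ0, hJ⟩ := exists_map_smul_eq_smul ν (inv_ne_zero ht)
  refine ⟨J, hJ0, fun r => ?_⟩
  have hpre : (t⁻¹ • ·) ⁻¹' Metric.closedBall (0 : X) r = Metric.closedBall 0 (‖t‖ * r) := by
    ext x
    simp [norm_smul, inv_mul_le_iff₀ (norm_pos_iff.2 ht)]
  rw [← hpre, ← map_measureReal_apply (by fun_prop) Metric.isClosed_closedBall.measurableSet, hJ]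
  exact measureReal_nnreal_smul_apply J

/-- The ball of radius `R` and the annuli `‖t‖ ^ d * R ≤ ‖x‖ ≤ ‖t‖ ^ (d + 1) * R` cover the
space, and the volume of the latter grows only exponentially. -/
lemma integrable_of_norm_le_pow_two_pow {f : X → ℂ} (hf : Continuous f) (ht : 1 < ‖t‖) {R θ : ℝ}
    (hR : 0 < R) (hθ0 : 0 < θ) (hθ1 : θ < 1)
    (h : ∀ (d : ℕ) (x : X), ‖t‖ ^ d * R ≤ ‖x‖ → ‖f x‖ ≤ θ ^ 2 ^ d) : Integrable f ν := by
  obtain ⟨c, hc, hball⟩ :=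
    exists_measureReal_closedBall_norm_mul ν (norm_pos_iff.1 (one_pos.trans ht))
  have hvol : ∀ d : ℕ, ν.real (Metric.closedBall 0 (‖t‖ ^ d * R)) =
      c ^ d * ν.real (Metric.closedBall 0 R) := fun d => by
    induction d with
    | zero => simp
    | succ d ih => rw [pow_succ', mul_assoc, hball, ih, pow_succ', mul_assoc]
  let S : ℕ → Set X := fun d =>
    Metric.closedBall 0 (‖t‖ ^ (d + 1) * R) \ Metric.ball 0 (‖t‖ ^ d * R)
  have hSball : ∀ d, S d ⊆ Metric.closedBall 0 (‖t‖ ^ (d + 1) * R) := fun d => Set.sdiff_subset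
  have hon : ∀ r, IntegrableOn f (Metric.closedBall 0 r) ν := fun r =>
    hf.continuousOn.integrableOn_compact (isCompact_closedBall _ _)
  have hSint : ∀ d, ∫ x in S d, ‖f x‖ ∂ν ≤
      θ ^ 2 ^ d * c ^ d * (c * ν.real (Metric.closedBall 0 R)) := fun d => by
    have hle := norm_setIntegral_le_of_norm_le_const (μ := ν) (s := S d) (f := fun x => ‖f x‖)
      ((measure_mono (hSball d)).trans_lt measure_closedBall_lt_top) fun x hx => by
        simpa using h d x (by simpa using hx.2)
    calc ∫ x in S d, ‖f x‖ ∂ν ≤ θ ^ 2 ^ d * ν.real (S d) := (Real.le_norm_self _).trans hle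
      _ ≤ θ ^ 2 ^ d * ν.real (Metric.closedBall 0 (‖t‖ ^ (d + 1) * R)) := by
        gcongr
        exacts [measure_closedBall_lt_top.ne, hSball d]
      _ = _ := by rw [hvol]; ring
  have hUnion : IntegrableOn f (⋃ d, S d) ν := by
    refine integrableOn_iUnion_of_summable_integral_norm
      (fun d => (hon _).mono_set (hSball d)) ?_
    exact .of_nonneg_of_le (fun d => integral_nonneg fun _ => norm_nonneg _) hSint
      ((summable_pow_two_pow_mul_pow hθ0 hθ1 hc).mul_right _)
  refine integrableOn_univ.1 (((hon R).union hUnion).mono_set fun x _ => ?_)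
  obtain hx | hx := le_or_gt ‖x‖ R
  · exact .inl (by simpa using hx)
  · obtain ⟨d, hd, hd'⟩ := exists_nat_pow_near ((one_le_div hR).2 hx.le) ht
    refine .inr (Set.mem_iUnion.2 ⟨d, ?_, ?_⟩)
    · simpa using (div_le_iff₀ hR).1 hd'.le
    · simpa using (le_div_iff₀ hR).1 hd

end Homothety

lemma eq_apply_zero_of_tendsto_iterate {X Y : Type*} [TopologicalSpace X] [Zero X]
    [TopologicalSpace Y] [T2Space Y] {f : X → Y} {A : X → X} (hf : ContinuousAt f 0)
    (hfA : ∀ x, f (A x) = f x) {x : X} (hAx : Tendsto (fun n : ℕ => A^[n] x) atTop (𝓝 0)) :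
    f x = f 0 := by
  have hiter : ∀ n : ℕ, f (A^[n] x) = f x := fun n => by
    induction n with
    | zero => rfl
    | succ n ih => rw [Function.iterate_succ_apply', hfA, ih]
  exact tendsto_nhds_unique tendsto_const_nhds
    ((hf.tendsto.comp hAx).congr hiter)

section ProductFormula

variable {K E : Type*} [NontriviallyNormedField K] [NormedAddCommGroup E] [NormedSpace K E]
  [ProperSpace E] [MeasurableSpace E] [BorelSpace E] {ν : Measure E} [ν.IsAddHaarMeasure]
  {φ : E → ℂ}

lemma integrable_of_norm_le_mul {A B : E ≃L[K] E} (hφ : Continuous φ) (h1 : ∀ x, ‖φ x‖ ≤ 1)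
    (hb : Bornology.IsBounded {x | ‖φ x‖ = 1})
    (hA : ∀ x, Tendsto (fun n : ℕ => A^[n] x) atTop (𝓝 0))
    (hAB : ∀ x, ‖φ x‖ ≤ ‖φ (A x)‖ * ‖φ (B x)‖) : Integrable φ ν := by
  obtain ⟨t, ht⟩ := NormedField.exists_lt_norm K
    (max 1 (max ‖(A.symm : E →L[K] E)‖₊ ‖(B.symm : E →L[K] E)‖₊))
  simp only [max_lt_iff] at ht
  have ht0 : 0 < ‖t‖ := one_pos.trans ht.1
  have hAt : ∀ x, ‖x‖ ≤ ‖t‖ * ‖A x‖ := fun x =>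
    (A.antilipschitz.le_mul_norm A.map_zero x).trans (by gcongr; exact ht.2.1.le)
  have hBt : ∀ x, ‖x‖ ≤ ‖t‖ * ‖B x‖ := fun x =>
    (B.antilipschitz.le_mul_norm B.map_zero x).trans (by gcongr; exact ht.2.2.le)
  obtain ⟨R, hR, θ, hθ0, hθ1, hθ⟩ := exists_lt_one_forall_le_of_tendsto_iterate hφ.norm h1 hb ht0
    hAt hA fun x => (hAB x).trans (mul_le_of_le_one_right (norm_nonneg _) (h1 _))
  exact integrable_of_norm_le_pow_two_pow hφ ht.1 hR hθ0 hθ1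
    (le_pow_two_pow_of_le_mul (fun _ => norm_nonneg _) ht0 hAt hBt hAB hθ)

lemma integrable_of_eq_prod {ι : Type*} [Fintype ι] {A : ι → E ≃L[K] E} (hφ : Continuous φ)
    (h0 : φ 0 = 1) (h1 : ∀ x, ‖φ x‖ ≤ 1) (hb : Bornology.IsBounded {x | ‖φ x‖ = 1})
    {i : ι} (hA : ∀ x, Tendsto (fun n : ℕ => (A i)^[n] x) atTop (𝓝 0))
    (hprod : ∀ x, φ x = ∏ i, φ (A i x)) : Integrable φ ν := by
  classical
  by_cases! hι : ∃ j, i ≠ j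
  · obtain ⟨j, hij⟩ := hι
    refine integrable_of_norm_le_mul (A := A i) (B := A j) hφ h1 hb hA fun x => ?_
    calc ‖φ x‖ = (∏ k ∈ Finset.univ \ {i, j}, ‖φ (A k x)‖) * ∏ k ∈ {i, j}, ‖φ (A k x)‖ := by
          rw [hprod, norm_prod, Finset.prod_sdiff (Finset.subset_univ _)]
      _ ≤ 1 * ∏ k ∈ {i, j}, ‖φ (A k x)‖ := by
          gcongr
          exact Finset.prod_le_one (fun _ _ => norm_nonneg _) fun _ _ => h1 _
      _ = ‖φ (A i x)‖ * ‖φ (A j x)‖ := by rw [one_mul, Finset.prod_pair hij]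
  · have hφA : ∀ x, φ (A i x) = φ x := fun x => by
      rw [hprod x, Fintype.prod_eq_single i fun j hj => absurd (hι j).symm hj]
    have hφ1 : ∀ x, φ x = 1 := fun x =>
      (eq_apply_zero_of_tendsto_iterate hφ.continuousAt hφA (hA x)).trans h0
    have : CompactSpace E := Metric.compactSpace_iff_isBounded_univ.2 (by simpa [hφ1] using hb)
    exact hφ.integrable_of_hasCompactSupport (.of_compactSpace φ)

end ProductFormula

section Dual

variable {K X F : Type*} [NontriviallyNormedField K] [CompleteSpace K] [NormedAddCommGroup X]
  [NormedSpace K X] [FiniteDimensional K X] [NormedAddCommGroup F] [NormedSpace K F]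

open Module in
lemma tendsto_clm_iff_forall_apply {α : Type*} {l : Filter α} {f : α → X →L[K] F}
    {g : X →L[K] F} : Tendsto f l (𝓝 g) ↔ ∀ x, Tendsto (fun a => f a x) l (𝓝 (g x)) := by
  refine ⟨fun h x => ((ContinuousLinearMap.apply K F x).continuous.tendsto g).comp h, fun h => ?_⟩
  let e : (X →L[K] F) ≃L[K] Fin (finrank K X) → F :=
    ((ContinuousLinearEquiv.ofFinrankEq (finrank_fin_fun K).symm).arrowCongr
      (1 : F ≃L[K] F)).trans (ContinuousLinearEquiv.piRing _)
  rw [e.toHomeomorph.isInducing.tendsto_nhds_iff]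
  exact tendsto_pi_nhds.2 fun i => h _

lemma tendsto_iterate_arrowCongr {A : X ≃L[K] X}
    (hA : ∀ x, Tendsto (fun n : ℕ => A^[n] x) atTop (𝓝 0)) (ξ : X →L[K] F) :
    Tendsto (fun n : ℕ => (A.symm.arrowCongr (.refl K F))^[n] ξ) atTop (𝓝 0) := by
  have hiter : ∀ (n : ℕ) x, (A.symm.arrowCongr (.refl K F))^[n] ξ x = ξ (A^[n] x) := fun n => by
    induction n with
    | zero => simp
    | succ n ih =>
      intro x
      rw [Function.iterate_succ_apply', Function.iterate_succ_apply, ← ih]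
      rfl
  refine tendsto_clm_iff_forall_apply.2 fun x => ?_
  simp_rw [hiter]
  simpa [Function.comp_def] using (ξ.continuous.tendsto 0).comp (hA x)

end Dual

/-! ### Closed subgroups without lines -/

/-- Over `K`, a closed subgroup of a finite-dimensional space which is stable under a contraction
and contains no line is bounded. This is the only property of the base field, besides its Fourier
analysis, that distinguishes the real from the `p`-adic argument. -/
def HasBoundedLineFreeSubgroups (K : Type u) [NontriviallyNormedField K] : Prop :=
  ∀ (E : Type u) [NormedAddCommGroup E] [NormedSpace K E] [FiniteDimensional K E] (A : E ≃L[K] E),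
    (∀ x, Tendsto (fun n : ℕ => A^[n] x) atTop (𝓝 0)) →
    ∀ H : AddSubgroup E, IsClosed (H : Set E) → Set.MapsTo A H H →
      (∀ η : E, (∀ t : K, t • η ∈ H) → η = 0) → Bornology.IsBounded (H : Set E)

lemma tendsto_mul_floor_div {α : Type*} {l : Filter α} {r : α → ℝ} (hr : ∀ a, 0 < r a)
    (hlim : Tendsto r l (𝓝 0)) (t : ℝ) : Tendsto (fun a => r a * ⌊t / r a⌋) l (𝓝 t) := by
  refine tendsto_iff_dist_tendsto_zero.2
    (squeeze_zero (fun _ => dist_nonneg) (fun a => ?_) hlim)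
  have hfract : t - r a * ⌊t / r a⌋ = r a * Int.fract (t / r a) := by
    rw [Int.fract, mul_sub, mul_div_cancel₀ _ (hr a).ne']
  rw [dist_comm, Real.dist_eq, hfract, abs_of_nonneg (mul_nonneg (hr a).le (Int.fract_nonneg _))]
  exact mul_le_of_le_one_right (hr a).le (Int.fract_lt_one _).le

lemma exists_line_of_tendsto_zero {E : Type*} [NormedAddCommGroup E] [NormedSpace ℝ E]
    [ProperSpace E] {H : AddSubgroup E} (hH : IsClosed (H : Set E)) {u : ℕ → E}
    (hu : ∀ n, u n ∈ H) (hu0 : ∀ n, u n ≠ 0) (hlim : Tendsto u atTop (𝓝 0)) :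
    ∃ η : E, η ≠ 0 ∧ ∀ t : ℝ, t • η ∈ H := by
  obtain ⟨η, hη, φ, hφ, hφlim⟩ := (isCompact_sphere (0 : E) 1).tendsto_subseq
    (x := fun n => ‖u n‖⁻¹ • u n) fun n => by
      simp [norm_smul, inv_mul_cancel₀ (norm_ne_zero_iff.2 (hu0 n))]
  refine ⟨η, ne_zero_of_mem_unit_sphere ⟨η, hη⟩, fun t => ?_⟩
  have hpos : ∀ n, 0 < ‖u (φ n)‖ := fun n => norm_pos_iff.2 (hu0 _)
  have hnorm : Tendsto (fun n => ‖u (φ n)‖) atTop (𝓝 0) := by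
    simpa using (hlim.comp hφ.tendsto_atTop).norm
  refine hH.mem_of_tendsto ((tendsto_mul_floor_div hpos hnorm t).smul hφlim)
    (.of_forall fun n => ?_)
  have hmul : (‖u (φ n)‖ * ⌊t / ‖u (φ n)‖⌋) • ‖u (φ n)‖⁻¹ • u (φ n) =
      ⌊t / ‖u (φ n)‖⌋ • u (φ n) := by
    rw [smul_smul, mul_right_comm, mul_inv_cancel₀ (hpos n).ne', one_mul, Int.cast_smul_eq_zsmul]
  exact hmul ▸ H.zsmul_mem (hu _) _

lemma hasBoundedLineFreeSubgroups_real : HasBoundedLineFreeSubgroups ℝ := by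
  intro E _ _ _ A hA H hH hAH hline
  have : ProperSpace E := FiniteDimensional.proper ℝ E
  suffices H = ⊥ by simp [this]
  refine (AddSubgroup.eq_bot_iff_forall H).2 fun x hx => ?_
  by_contra hx0
  obtain ⟨η, hη, hηH⟩ := exists_line_of_tendsto_zero hH (fun n => hAH.iterate n hx)
    (fun n h => hx0 (A.injective.iterate n (h.trans (iterate_map_zero A n).symm))) (hA x)
  exact hη (hline η hηH)

section Padic

variable {p : ℕ} [Fact p.Prime]

lemma smul_mem_of_norm_le_one {E : Type*} [NormedAddCommGroup E] [NormedSpace ℚ_[p] E]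
    {H : AddSubgroup E} (hH : IsClosed (H : Set E)) {a : ℚ_[p]} (ha : ‖a‖ ≤ 1) {x : E}
    (hx : x ∈ H) : a • x ∈ H := by
  have hclosed : IsClosed {z : ℤ_[p] | (z : ℚ_[p]) • x ∈ H} :=
    hH.preimage (continuous_subtype_val.smul continuous_const)
  exact PadicInt.denseRange_natCast.induction_on (p := fun z : ℤ_[p] => (z : ℚ_[p]) • x ∈ H)
    ⟨a, ha⟩ hclosed fun n => by simpa [Nat.cast_smul_eq_nsmul] using H.nsmul_mem hx n

lemma exists_line_of_not_isBounded {E : Type*} [NormedAddCommGroup E] [NormedSpace ℚ_[p] E]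
    [ProperSpace E] {H : AddSubgroup E} (hH : IsClosed (H : Set E))
    (hb : ¬Bornology.IsBounded (H : Set E)) : ∃ η : E, η ≠ 0 ∧ ∀ t : ℚ_[p], t • η ∈ H := by
  obtain ⟨c, hc⟩ := NormedField.exists_one_lt_norm ℚ_[p]
  have hlarge : ∀ n : ℕ, ∃ x ∈ H, (n : ℝ) < ‖x‖ := fun n => by
    by_contra! hle
    exact hb (isBounded_iff_forall_norm_le.2 ⟨n, hle⟩)
  choose x hxH hx using hlarge
  choose d _ hd1 hdc _ using fun n => rescale_to_shell hc one_pos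
    (norm_pos_iff.1 ((Nat.cast_nonneg n).trans_lt (hx n)))
  have hd0 : Tendsto d atTop (𝓝 0) := by
    refine squeeze_zero_norm' ?_ tendsto_inv_atTop_nhds_zero_nat
    filter_upwards [eventually_gt_atTop 0] with n hn
    have hn' : (0 : ℝ) < n := Nat.cast_pos.2 hn
    rw [← one_div, le_div_iff₀ hn']
    calc ‖d n‖ * n ≤ ‖d n‖ * ‖x n‖ := by gcongr; exact (hx n).le
      _ ≤ 1 := by simpa only [norm_smul] using (hd1 n).le
  obtain ⟨η, -, φ, hφ, hlim⟩ := (isCompact_closedBall (0 : E) 1).tendsto_subseq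
    (x := fun n => d n • x n) fun n => by simpa using (hd1 n).le
  refine ⟨η, norm_pos_iff.1 ((by positivity : 0 < 1 / ‖c‖).trans_le ?_), fun t => ?_⟩
  · exact ge_of_tendsto' hlim.norm fun n => hdc _
  · have hsmall : ∀ᶠ n in atTop, ‖t * d (φ n)‖ < 1 :=
      ((hd0.comp hφ.tendsto_atTop).const_mul t).norm.eventually (gt_mem_nhds (by simp))
    refine hH.mem_of_tendsto (hlim.const_smul t) (hsmall.mono fun n hn => ?_)
    rw [SetLike.mem_coe, Function.comp_apply, smul_smul]
    exact smul_mem_of_norm_le_one hH hn.le (hxH (φ n))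

lemma hasBoundedLineFreeSubgroups_padic : HasBoundedLineFreeSubgroups ℚ_[p] := by
  intro E _ _ _ _ _ H hH _ hline
  have : ProperSpace E := FiniteDimensional.proper ℚ_[p] E
  by_contra hb
  obtain ⟨η, hη, hηH⟩ := exists_line_of_not_isBounded (p := p) hH hb
  exact hη (hline η hηH)

end Padic

/-! ### Fourier inversion -/

lemma hasBoundedContinuousDensity_of_forall_integral_mul_eq {X : Type*} [MetricSpace X]
    [ProperSpace X] [MeasurableSpace X] [BorelSpace X] {μ ν : Measure X} [IsLocallyFiniteMeasure μ]
    [IsLocallyFiniteMeasure ν] (f : X →ᵇ ℝ) (hf : ∀ x, 0 ≤ f x) {c : ℝ} (hc : 0 < c)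
    (h : ∀ g : X → ℝ, Continuous g → HasCompactSupport g → ∫ x, g x * f x ∂ν = c * ∫ x, g x ∂μ) :
    HasBoundedContinuousDensity μ ν := by
  have hd0 : ∀ x, 0 ≤ c⁻¹ * f x := fun x => mul_nonneg (inv_nonneg.2 hc.le) (hf x)
  have heq : μ = ν.withDensity fun x => ENNReal.ofReal ((c⁻¹ • f) x) := by
    have : IsLocallyFiniteMeasure (ν.withDensity fun x => ENNReal.ofReal ((c⁻¹ • f) x)) :=
      IsLocallyFiniteMeasure.withDensity_ofReal (c⁻¹ • f).continuous
    refine Measure.ext_of_integral_eq_on_compactlySupported fun g => ?_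
    rw [integral_withDensity_eq_integral_toReal_smul (by fun_prop) (by simp)]
    calc ∫ x, g x ∂μ = c⁻¹ * ∫ x, g x * f x ∂ν := by
          rw [h g g.continuous g.hasCompactSupport, inv_mul_cancel_left₀ hc.ne']
      _ = ∫ x, (ENNReal.ofReal ((c⁻¹ • f) x)).toReal • g x ∂ν := by
          simp only [ENNReal.toReal_ofReal (hd0 _), ← integral_const_mul,
            BoundedContinuousFunction.coe_smul, smul_eq_mul, mul_assoc, mul_comm (f _)]
  exact ⟨heq ▸ withDensity_absolutelyContinuous _ _, c⁻¹ • f, hd0, heq⟩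

/-- A summability kernel for Fourier inversion on `X` with respect to the pairing
`(ξ, x) ↦ ψ (B ξ x)`: an integrable `G` with `G 0 = 1`, continuous at `0`, whose Fourier
transform `k` is a nonnegative integrable function with positive integral. -/
structure IsSummabilityKernel {K X : Type*} [NontriviallyNormedField K] [NormedAddCommGroup X]
    [NormedSpace K X] [MeasurableSpace X] (ψ : AddChar K Circle) (B : X →L[K] X →L[K] K)
    (ν : Measure X) (G k : X → ℝ) : Prop where
  integrable : Integrable G ν
  norm_le_one : ∀ ξ, ‖G ξ‖ ≤ 1
  continuousAt_zero : ContinuousAt G 0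
  apply_zero : G 0 = 1
  continuous_transform : Continuous k
  transform_nonneg : ∀ x, 0 ≤ k x
  integrable_transform : Integrable k ν
  integral_transform_pos : 0 < ∫ x, k x ∂ν
  transform_eq : ∀ x, (k x : ℂ) = ∫ ξ, (G ξ : ℂ) * ψ (B ξ x) ∂ν

section Inversion

variable {K X : Type*} [NontriviallyNormedField K] [NormedAddCommGroup X] [NormedSpace K X]
  [MeasurableSpace X] {ψ : AddChar K Circle} {B : X →L[K] X →L[K] K} {ν μ : Measure X}
  {G k : X → ℝ} {s : K}

/-- The Fourier inversion integral of `μ` at `z`, regularised by the factor `G (s • ξ)`. If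
`G 0 = 1`, the scale `s = 0` is the unregularised integral. -/
noncomputable def fourierInvIntegral (ψ : AddChar K Circle) (B : X →L[K] X →L[K] K)
    (ν : Measure X) (G : X → ℝ) (μ : Measure X) (s : K) (z : X) : ℂ :=
  ∫ ξ, (G (s • ξ) : ℂ) * (addCharFun ψ μ (B ξ) * ψ (B ξ (-z))) ∂ν

lemma IsSummabilityKernel.norm_transform_le (hk : IsSummabilityKernel ψ B ν G k) (x : X) :
    ‖k x‖ ≤ ∫ ξ, ‖G ξ‖ ∂ν := by
  rw [← Complex.norm_real, hk.transform_eq]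
  exact norm_integral_le_of_norm_le hk.integrable.norm (ae_of_all _ fun ξ => by
    rw [norm_mul, Circle.norm_coe, mul_one, Complex.norm_real])

lemma IsSummabilityKernel.norm_integrand_le (hk : IsSummabilityKernel ψ B ν G k) (s : K) (z ξ : X) :
    ‖(G (s • ξ) : ℂ) * (addCharFun ψ μ (B ξ) * ψ (B ξ (-z)))‖ ≤ ‖addCharFun ψ μ (B ξ)‖ := by
  rw [norm_mul, norm_mul, Circle.norm_coe, mul_one, Complex.norm_real]
  exact mul_le_of_le_one_left (norm_nonneg _) (hk.norm_le_one _)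

lemma IsSummabilityKernel.norm_fourierInvIntegral_le (hk : IsSummabilityKernel ψ B ν G k)
    (hμ : Integrable (fun ξ => addCharFun ψ μ (B ξ)) ν) (s : K) (z : X) :
    ‖fourierInvIntegral ψ B ν G μ s z‖ ≤ ∫ ξ, ‖addCharFun ψ μ (B ξ)‖ ∂ν :=
  norm_integral_le_of_norm_le hμ.norm (ae_of_all _ (hk.norm_integrand_le s z))

variable [BorelSpace X]

lemma IsSummabilityKernel.tendsto_integral_comp_sub_smul_mul [IsFiniteMeasure μ]
    (hk : IsSummabilityKernel ψ B ν G k) {g : X → ℝ} (hg : Continuous g)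
    (hgc : HasCompactSupport g) :
    Tendsto (fun s : K => ∫ y, ∫ x, g (y - s • x) * k x ∂ν ∂μ) (𝓝 0)
      (𝓝 ((∫ x, k x ∂ν) * ∫ y, g y ∂μ)) := by
  obtain ⟨M, hM⟩ := hgc.exists_bound_of_continuous hg
  have hbound : ∀ (s : K) y x, ‖g (y - s • x) * k x‖ ≤ M * ‖k x‖ := fun s y x => by
    rw [norm_mul]
    gcongr
    exact hM _
  have hbound_int : Integrable (fun x => M * ‖k x‖) ν := hk.integrable_transform.norm.const_mul M
  have hcont : Continuous fun p : (K × X) × X => g (p.1.2 - p.1.1 • p.2) * k p.2 :=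
    (hg.comp (by fun_prop)).mul (hk.continuous_transform.comp continuous_snd)
  have hinner : Continuous fun p : K × X => ∫ x, g (p.2 - p.1 • x) * k x ∂ν :=
    continuous_of_dominated (fun p => (hcont.comp (.prodMk_right p)).aestronglyMeasurable)
      (fun p => ae_of_all _ (hbound p.1 p.2)) hbound_int
      (ae_of_all _ fun x => hcont.comp (.prodMk_left x))
  have houter : Continuous fun s : K => ∫ y, ∫ x, g (y - s • x) * k x ∂ν ∂μ :=
    continuous_of_dominated (fun s => (hinner.comp (.prodMk_right s)).aestronglyMeasurable)
      (fun s => ae_of_all _ fun y => norm_integral_le_of_norm_le hbound_int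
        (ae_of_all _ (hbound s y))) (integrable_const _)
      (ae_of_all _ fun y => hinner.comp (.prodMk_left y))
  simpa [integral_const_mul, integral_mul_const, mul_comm] using houter.tendsto 0

variable [ProperSpace X] [ν.IsAddHaarMeasure]

lemma aestronglyMeasurable_fourierInvIntegrand (hψ : Continuous ψ) (hG : Integrable G ν)
    (hμ : Integrable (fun ξ => addCharFun ψ μ (B ξ)) ν) (s : K) (z : X) :
    AEStronglyMeasurable (fun ξ => (G (s • ξ) : ℂ) * (addCharFun ψ μ (B ξ) * ψ (B ξ (-z)))) ν := by
  have hGs : AEStronglyMeasurable (fun ξ => (G (s • ξ) : ℂ)) ν := by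
    obtain rfl | hs := eq_or_ne s 0
    · simpa using aestronglyMeasurable_const
    · exact (integrable_comp_smul_of_ne_zero hs hG).ofReal.1
  exact hGs.mul (hμ.1.mul
    (continuous_subtype_val.comp (hψ.comp (by fun_prop))).aestronglyMeasurable)

lemma IsSummabilityKernel.continuous_fourierInvIntegral (hψ : Continuous ψ)
    (hk : IsSummabilityKernel ψ B ν G k)
    (hμ : Integrable (fun ξ => addCharFun ψ μ (B ξ)) ν) (s : K) :
    Continuous (fourierInvIntegral ψ B ν G μ s) :=
  continuous_of_dominated (aestronglyMeasurable_fourierInvIntegrand hψ hk.integrable hμ s)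
    (fun z => ae_of_all _ (hk.norm_integrand_le s z)) hμ.norm
    (ae_of_all _ fun _ => continuous_const.mul (continuous_const.mul
      (continuous_subtype_val.comp (hψ.comp (by fun_prop)))))

lemma IsSummabilityKernel.tendsto_fourierInvIntegral (hψ : Continuous ψ)
    (hk : IsSummabilityKernel ψ B ν G k)
    (hμ : Integrable (fun ξ => addCharFun ψ μ (B ξ)) ν) (z : X) :
    Tendsto (fun s => fourierInvIntegral ψ B ν G μ s z) (𝓝 0)
      (𝓝 (fourierInvIntegral ψ B ν G μ 0 z)) := by
  refine tendsto_integral_filter_of_dominated_convergence (fun ξ => ‖addCharFun ψ μ (B ξ)‖)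
    (.of_forall fun s => aestronglyMeasurable_fourierInvIntegrand hψ hk.integrable hμ s z)
    (.of_forall fun s => ae_of_all _ (hk.norm_integrand_le s z)) hμ.norm
    (ae_of_all _ fun ξ => ?_)
  have hG : ContinuousAt (fun s : K => G (s • ξ)) 0 :=
    ContinuousAt.comp (g := G) (by simpa using hk.continuousAt_zero) (by fun_prop)
  exact ((Complex.continuous_ofReal.tendsto _).comp hG).mul_const _

/-- At a scale `s ≠ 0`, regularised Fourier inversion is convolution with the kernel rescaled
by `s`. -/
lemma IsSummabilityKernel.mul_re_fourierInvIntegral [IsFiniteMeasure μ] (hψ : Continuous ψ)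
    (hk : IsSummabilityKernel ψ B ν G k) (hs : s ≠ 0) {J : NNReal}
    (hJ : ν.map (s⁻¹ • ·) = J • ν) (z : X) :
    J * (fourierInvIntegral ψ B ν G μ s z).re = ∫ y, k (s⁻¹ • (y - z)) ∂μ := by
  have hint : Integrable (fun p : X × X => (G (s • p.1) : ℂ) * ψ (B p.1 (p.2 - z)))
      (ν.prod μ) := by
    have hG : Integrable (fun p : X × X => (G (s • p.1) : ℂ)) (ν.prod μ) :=
      (integrable_comp_smul_of_ne_zero hs hk.integrable).ofReal.comp_fst
        (f := fun ξ => (G (s • ξ) : ℂ)) μ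
    exact hG.mul_bdd (c := 1)
      (continuous_subtype_val.comp (hψ.comp (by fun_prop))).aestronglyMeasurable
      (ae_of_all _ fun _ => (Circle.norm_coe _).le)
  have hscale : ∀ y, (k (s⁻¹ • (y - z)) : ℂ) =
      (J : ℝ) * ∫ ξ, (G (s • ξ) : ℂ) * ψ (B ξ (y - z)) ∂ν := fun y => by
    have h := integral_comp_smul_of_map_eq (inv_ne_zero hs) hJ
      fun ξ => (G (s • ξ) : ℂ) * ψ (B ξ (y - z))
    rw [hk.transform_eq]
    simpa [hs] using h
  have hcomplex : (J : ℝ) * fourierInvIntegral ψ B ν G μ s z =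
      (∫ y, k (s⁻¹ • (y - z)) ∂μ : ℝ) := calc
    _ = (J : ℝ) * ∫ ξ, ∫ y, (G (s • ξ) : ℂ) * ψ (B ξ (y - z)) ∂μ ∂ν := by
        simp only [fourierInvIntegral, addCharFun, integral_const_mul, integral_mul_const,
          sub_eq_add_neg, map_add, AddChar.map_add_eq_mul, Circle.coe_mul]
    _ = ∫ y, (J : ℝ) * ∫ ξ, (G (s • ξ) : ℂ) * ψ (B ξ (y - z)) ∂ν ∂μ := by
        rw [integral_integral_swap hint, integral_const_mul]
    _ = (∫ y, k (s⁻¹ • (y - z)) ∂μ : ℝ) := by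
        simp only [← hscale, integral_complex_ofReal]
  rw [← Complex.re_ofReal_mul, hcomplex, Complex.ofReal_re]

lemma IsSummabilityKernel.re_fourierInvIntegral_nonneg [IsFiniteMeasure μ] (hψ : Continuous ψ)
    (hk : IsSummabilityKernel ψ B ν G k) (hs : s ≠ 0) (z : X) :
    0 ≤ (fourierInvIntegral ψ B ν G μ s z).re := by
  obtain ⟨J, hJ0, hJ⟩ := exists_map_smul_eq_smul ν (inv_ne_zero hs)
  refine nonneg_of_mul_nonneg_right ?_ (NNReal.coe_pos.2 hJ0)
  rw [hk.mul_re_fourierInvIntegral hψ hs hJ]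
  exact integral_nonneg fun _ => hk.transform_nonneg _

lemma IsSummabilityKernel.integral_mul_re_fourierInvIntegral [IsFiniteMeasure μ]
    (hψ : Continuous ψ) (hk : IsSummabilityKernel ψ B ν G k) (hs : s ≠ 0) {g : X → ℝ}
    (hg : Integrable g ν) :
    ∫ z, g z * (fourierInvIntegral ψ B ν G μ s z).re ∂ν =
      ∫ y, ∫ x, g (y - s • x) * k x ∂ν ∂μ := by
  obtain ⟨J, hJ0, hJ⟩ := exists_map_smul_eq_smul ν (inv_ne_zero hs)
  have hJ0' : (J : ℝ) ≠ 0 := (NNReal.coe_pos.2 hJ0).ne'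
  have hre : ∀ z, (fourierInvIntegral ψ B ν G μ s z).re =
      (J : ℝ)⁻¹ * ∫ y, k (s⁻¹ • (y - z)) ∂μ := fun z =>
    (eq_inv_mul_iff_mul_eq₀ hJ0').2 (hk.mul_re_fourierInvIntegral hψ hs hJ z)
  have hint : Integrable (fun p : X × X => g p.1 * k (s⁻¹ • (p.2 - p.1))) (ν.prod μ) :=
    (hg.comp_fst μ).mul_bdd (c := ∫ ξ, ‖G ξ‖ ∂ν)
      (hk.continuous_transform.comp (by fun_prop)).aestronglyMeasurable
      (ae_of_all _ fun _ => hk.norm_transform_le _)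
  have hscale : ∀ y, ∫ z, g z * k (s⁻¹ • (y - z)) ∂ν = J * ∫ x, g (y - s • x) * k x ∂ν :=
    fun y => by
      rw [← integral_sub_left_eq_self _ ν y]
      simpa [hs] using integral_comp_smul_of_map_eq (inv_ne_zero hs) hJ
        fun x => g (y - s • x) * k x
  calc ∫ z, g z * (fourierInvIntegral ψ B ν G μ s z).re ∂ν
      = (J : ℝ)⁻¹ * ∫ z, ∫ y, g z * k (s⁻¹ • (y - z)) ∂μ ∂ν := by
        simp only [hre, mul_left_comm (g _), integral_const_mul]
    _ = (J : ℝ)⁻¹ * ∫ y, J * ∫ x, g (y - s • x) * k x ∂ν ∂μ := by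
        rw [integral_integral_swap hint]
        simp only [hscale]
    _ = ∫ y, ∫ x, g (y - s • x) * k x ∂ν ∂μ := by
        rw [integral_const_mul, inv_mul_cancel_left₀ hJ0']

theorem hasBoundedContinuousDensity_of_integrable_addCharFun [IsFiniteMeasure μ]
    (hψ : Continuous ψ) (hk : IsSummabilityKernel ψ B ν G k)
    (hμ : Integrable (fun ξ => addCharFun ψ μ (B ξ)) ν) :
    HasBoundedContinuousDensity μ ν := by
  let f : X →ᵇ ℝ := .ofNormedAddCommGroup (fun z => (fourierInvIntegral ψ B ν G μ 0 z).re)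
    (Complex.continuous_re.comp (hk.continuous_fourierInvIntegral hψ hμ 0))
    (∫ ξ, ‖addCharFun ψ μ (B ξ)‖ ∂ν)
    fun z => (Complex.abs_re_le_norm _).trans (hk.norm_fourierInvIntegral_le hμ 0 z)
  have hlim : ∀ z, Tendsto (fun s => (fourierInvIntegral ψ B ν G μ s z).re) (𝓝[≠] 0) (𝓝 (f z)) :=
    fun z => (Complex.continuous_re.tendsto _).comp
      ((hk.tendsto_fourierInvIntegral hψ hμ z).mono_left nhdsWithin_le_nhds)
  refine hasBoundedContinuousDensity_of_forall_integral_mul_eq f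
    (fun z => ge_of_tendsto (hlim z) ?_) hk.integral_transform_pos fun g hg hgc => ?_
  · exact eventually_mem_nhdsWithin.mono fun s hs => hk.re_fourierInvIntegral_nonneg hψ hs z
  · have hgi : Integrable g ν := hg.integrable_of_hasCompactSupport hgc
    refine tendsto_nhds_unique (l := 𝓝[≠] 0)
      (f := fun s : K => ∫ z, g z * (fourierInvIntegral ψ B ν G μ s z).re ∂ν) ?_ ?_
    · refine tendsto_integral_filter_of_dominated_convergence
        (fun z => ‖g z‖ * ∫ ξ, ‖addCharFun ψ μ (B ξ)‖ ∂ν)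
        (.of_forall fun s => hgi.1.mul (Complex.continuous_re.comp
          (hk.continuous_fourierInvIntegral hψ hμ s)).aestronglyMeasurable)
        (.of_forall fun s => ae_of_all _ fun z => ?_) (hgi.norm.mul_const _)
        (ae_of_all _ fun z => (hlim z).const_mul _)
      rw [norm_mul]
      gcongr
      exact (Complex.abs_re_le_norm _).trans (hk.norm_fourierInvIntegral_le hμ s z)
    · refine ((hk.tendsto_integral_comp_sub_smul_mul hg hgc).mono_left
        nhdsWithin_le_nhds).congr' ?_
      exact eventually_mem_nhdsWithin.mono fun s hs =>
        (hk.integral_mul_re_fourierInvIntegral hψ hs hgi).symm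

end Inversion

/-! ### Summability kernels over the real and the `p`-adic numbers -/

/-- The self-duality of `Fin d → K` given by the dot product. -/
noncomputable def dotProductDual (K : Type*) [NontriviallyNormedField K] [CompleteSpace K]
    (d : ℕ) : (Fin d → K) ≃L[K] ((Fin d → K) →L[K] K) :=
  ((dotProductEquiv K (Fin d)).trans LinearMap.toContinuousLinearMap).toContinuousLinearEquiv

lemma dotProductDual_apply {K : Type*} [NontriviallyNormedField K] [CompleteSpace K]
    {d : ℕ} (ξ x : Fin d → K) : dotProductDual K d ξ x = ∑ i, ξ i * x i := rfl

lemma coe_addChar_sum {A ι : Type*} [AddCommMonoid A] (ψ : AddChar A Circle) (s : Finset ι)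
    (f : ι → A) : (ψ (∑ i ∈ s, f i) : ℂ) = ∏ i ∈ s, (ψ (f i) : ℂ) :=
  map_prod (Circle.coeHom.comp ψ.toMonoidHom) (fun i => Multiplicative.ofAdd (f i)) s

lemma IsSummabilityKernel.pi {K : Type*} [NontriviallyNormedField K] [CompleteSpace K]
    [MeasurableSpace K] {ψ : AddChar K Circle} {ν : Measure K} [SigmaFinite ν]
    {G k : K → ℝ} (hk : IsSummabilityKernel ψ (.mul K K) ν G k) (d : ℕ) :
    IsSummabilityKernel ψ (dotProductDual K d : (Fin d → K) →L[K] (Fin d → K) →L[K] K)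
      (Measure.pi fun _ => ν) (fun ξ => ∏ i, G (ξ i)) (fun x => ∏ i, k (x i)) where
  integrable := .fintype_prod fun _ => hk.integrable
  norm_le_one ξ := by
    rw [norm_prod]
    exact Finset.prod_le_one (fun _ _ => norm_nonneg _) fun _ _ => hk.norm_le_one _
  continuousAt_zero := tendsto_finsetProd _ fun i _ =>
    hk.continuousAt_zero.comp (f := fun ξ : Fin d → K => ξ i) (continuousAt_apply i 0)
  apply_zero := Finset.prod_eq_one fun _ _ => hk.apply_zero
  continuous_transform := continuous_finsetProd _ fun i _ =>
    hk.continuous_transform.comp (continuous_apply i)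
  transform_nonneg x := Finset.prod_nonneg fun _ _ => hk.transform_nonneg _
  integrable_transform := .fintype_prod fun _ => hk.integrable_transform
  integral_transform_pos := by
    rw [integral_fintype_prod_eq_prod]
    exact Finset.prod_pos fun _ _ => hk.integral_transform_pos
  transform_eq x := by
    calc ((∏ i, k (x i) : ℝ) : ℂ)
        = ∏ i, ∫ ξ, (G ξ : ℂ) * ψ (ξ * x i) ∂ν := by
          simp only [Complex.ofReal_prod, hk.transform_eq, ContinuousLinearMap.mul_apply']
      _ = ∫ ξ : Fin d → K, ∏ i, (G (ξ i) : ℂ) * ψ (ξ i * x i) ∂Measure.pi fun _ => ν :=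
          (integral_fintype_prod_eq_prod fun i ξ => (G ξ : ℂ) * ψ (ξ * x i)).symm
      _ = _ := by
          simp [dotProductDual_apply, coe_addChar_sum, Finset.prod_mul_distrib]

lemma isSummabilityKernel_gaussian :
    IsSummabilityKernel Real.fourierChar (.mul ℝ ℝ) volume
      (fun ξ => Real.exp (-Real.pi * ξ ^ 2)) (fun x => Real.exp (-Real.pi * x ^ 2)) where
  integrable := integrable_exp_neg_mul_sq Real.pi_pos
  norm_le_one ξ := by
    rw [Real.norm_of_nonneg (Real.exp_pos _).le, Real.exp_le_one_iff, neg_mul, neg_nonpos]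
    positivity
  continuousAt_zero := by fun_prop
  apply_zero := by simp
  continuous_transform := by fun_prop
  transform_nonneg x := (Real.exp_pos _).le
  integrable_transform := integrable_exp_neg_mul_sq Real.pi_pos
  integral_transform_pos := integral_exp_pos (integrable_exp_neg_mul_sq Real.pi_pos)
  transform_eq x := by
    have h := congrFun (fourier_gaussian_pi (b := 1) (by simp)) (-x)
    simp only [Real.fourier_real_eq, Circle.smul_def] at h
    simpa [mul_comm] using h.symm

lemma fourierChar_ne_one : Real.fourierChar ≠ 1 := fun h => by
  have h2 : (Real.fourierChar (1 / 2) : ℂ) = -1 := by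
    rw [Real.fourierChar_apply, ← Complex.exp_pi_mul_I]
    congr 2
    push_cast
    ring
  norm_num [h] at h2

lemma exists_addChar_apply_ne_one {A : Type*} [AddCommGroup A] {a : A} (ha : a ≠ 0) :
    ∃ χ : AddChar A Circle, χ a ≠ 1 := by
  obtain ⟨c, hc⟩ := CharacterModule.exists_character_apply_ne_zero_of_ne_zero ha
  let r : AddCircle (1 : ℚ) →+ AddCircle (1 : ℝ) :=
    QuotientAddGroup.map _ _ (Rat.castHom ℝ).toAddMonoidHom
      ((AddSubgroup.zmultiples_le_of_mem (by simp)))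
  have hr : ∀ b, r b = 0 → b = 0 := fun b => by
    induction b using QuotientAddGroup.induction_on with
    | H q =>
      intro hq
      obtain ⟨n, hn⟩ := (AddCircle.coe_eq_zero_iff _).1 hq
      have hn' : n • (1 : ℝ) = q := hn
      exact (AddCircle.coe_eq_zero_iff _).2 ⟨n, by rw [zsmul_one] at hn' ⊢; exact mod_cast hn'⟩
  let c' : A →+ AddCircle (1 : ℚ) := c
  let τ : AddChar (AddCircle (1 : ℝ)) Circle :=
    { toFun := AddCircle.toCircle
      map_zero_eq_one' := AddCircle.toCircle_zero
      map_add_eq_mul' := AddCircle.toCircle_add }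
  refine ⟨τ.compAddMonoidHom (r.comp c'), fun h => hc (hr _ ?_)⟩
  exact AddCircle.injective_toCircle one_ne_zero (h.trans AddCircle.toCircle_zero.symm)

section Padic

variable {p : ℕ} [Fact p.Prime]

lemma exists_padic_addChar (p : ℕ) [Fact p.Prime] :
    ∃ ψ : AddChar ℚ_[p] Circle, (∀ x, ‖x‖ ≤ 1 → ψ x = 1) ∧ ψ (p : ℚ_[p])⁻¹ ≠ 1 := by
  let Z : AddSubgroup ℚ_[p] := (PadicInt.subring p).toAddSubgroup
  have hp : (QuotientAddGroup.mk' Z (p : ℚ_[p])⁻¹) ≠ 0 := by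
    rw [Ne, QuotientAddGroup.mk'_apply, QuotientAddGroup.eq_zero_iff]
    change ¬ ‖(p : ℚ_[p])⁻¹‖ ≤ 1
    simpa using (Fact.out : p.Prime).one_lt
  obtain ⟨χ, hχ⟩ := exists_addChar_apply_ne_one hp
  refine ⟨χ.compAddMonoidHom (QuotientAddGroup.mk' Z), fun x hx => ?_, hχ⟩
  have hxZ : QuotientAddGroup.mk' Z x = 0 := (QuotientAddGroup.eq_zero_iff x).2 hx
  simp [hxZ]

variable {ψ : AddChar ℚ_[p] Circle}

lemma continuous_padic_addChar (h1 : ∀ x, ‖x‖ ≤ 1 → ψ x = 1) : Continuous ψ := by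
  refine continuous_iff_continuousAt.2 fun x => (continuousAt_const (y := ψ x)).congr ?_
  filter_upwards [Metric.closedBall_mem_nhds x one_pos] with y hy
  have hyx : ψ (y - x) = 1 := h1 _ (by simpa [dist_eq_norm] using hy)
  exact (div_eq_one.1 ((AddChar.map_sub_eq_div ψ y x).symm.trans hyx)).symm

lemma integral_eq_zero_of_map_add_right_eq_mul {G : Type*} [AddGroup G] [MeasurableSpace G]
    [MeasurableAdd G] {ν : Measure G} [ν.IsAddRightInvariant] {f : G → ℂ} {g : G} {c : ℂ}
    (hc : c ≠ 1) (hf : ∀ x, f (x + g) = c * f x) : ∫ x, f x ∂ν = 0 := by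
  have h : ∫ x, f x ∂ν = c * ∫ x, f x ∂ν := by
    rw [← integral_const_mul, ← integral_add_right_eq_self f g]
    simp only [hf]
  by_contra h0
  exact hc (mul_right_cancel₀ h0 (h.symm.trans (one_mul _).symm))

lemma isClopen_padicInt : IsClopen (PadicInt.subring p : Set ℚ_[p]) := by
  simpa [Metric.closedBall, PadicInt.subring] using
    IsUltrametricDist.isClopen_closedBall (0 : ℚ_[p]) one_ne_zero

lemma isCompact_padicInt : IsCompact (PadicInt.subring p : Set ℚ_[p]) :=
  isCompact_iff_compactSpace.2 (PadicInt.compactSpace p)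

lemma inv_mul_mem_padicInt_of_notMem {x : ℚ_[p]} (hx : x ∉ PadicInt.subring p) :
    ((p : ℚ_[p]) * x)⁻¹ ∈ PadicInt.subring p := by
  have hxinv : ‖x⁻¹‖ < (p : ℝ) ^ (0 : ℤ) := by
    rw [norm_inv, zpow_zero]
    exact inv_lt_one_of_one_lt₀ (not_le.1 hx)
  have hp0 : (0 : ℝ) < p := mod_cast (Fact.out : p.Prime).pos
  change ‖((p : ℚ_[p]) * x)⁻¹‖ ≤ 1
  rw [mul_inv, norm_mul, norm_inv, Padic.norm_p, inv_inv, ← le_inv_mul_iff₀ hp0, mul_one]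
  simpa using (Padic.norm_lt_pow_iff_norm_le_pow_sub_one _ _).1 hxinv

lemma integral_indicator_mul_padic_addChar [MeasurableSpace ℚ_[p]] [BorelSpace ℚ_[p]]
    (ν : Measure ℚ_[p]) [ν.IsAddHaarMeasure] (h1 : ∀ x, ‖x‖ ≤ 1 → ψ x = 1)
    (hp : ψ (p : ℚ_[p])⁻¹ ≠ 1) (x : ℚ_[p]) :
    ∫ ξ, (((PadicInt.subring p : Set ℚ_[p]).indicator 1 ξ : ℝ) : ℂ) * ψ (ξ * x) ∂ν =
      ν.real (PadicInt.subring p) * ((PadicInt.subring p : Set ℚ_[p]).indicator 1 x : ℝ) := by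
  have hmeas : MeasurableSet (PadicInt.subring p : Set ℚ_[p]) :=
    isClopen_padicInt.isClosed.measurableSet
  by_cases hx : x ∈ PadicInt.subring p
  · have htriv : ∀ ξ, (((PadicInt.subring p : Set ℚ_[p]).indicator 1 ξ : ℝ) : ℂ) * ψ (ξ * x) =
        ((PadicInt.subring p : Set ℚ_[p]).indicator 1 ξ : ℝ) := fun ξ => by
      by_cases hξ : ξ ∈ PadicInt.subring p
      · rw [h1 _ (mul_mem hξ hx), Circle.coe_one, mul_one]
      · simp [hξ]
    simp only [htriv]
    rw [integral_complex_ofReal, integral_indicator_one hmeas]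
    simp [hx]
  · have hx0 : x ≠ 0 := by rintro rfl; exact hx (zero_mem _)
    have hmem := inv_mul_mem_padicInt_of_notMem hx
    rw [integral_eq_zero_of_map_add_right_eq_mul (g := ((p : ℚ_[p]) * x)⁻¹)
      (c := ψ (p : ℚ_[p])⁻¹) (mt Circle.coe_eq_one.1 hp) fun ξ => ?_]
    · simp [hx]
    · have hξ : (PadicInt.subring p : Set ℚ_[p]).indicator (1 : ℚ_[p] → ℝ) (ξ + (p * x)⁻¹) =
          (PadicInt.subring p : Set ℚ_[p]).indicator 1 ξ := by
        classical exact if_congr (add_mem_cancel_right hmem) rfl rfl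
      rw [hξ, add_mul, mul_inv, inv_mul_cancel_right₀ hx0, AddChar.map_add_eq_mul, Circle.coe_mul]
      ring

lemma isSummabilityKernel_padicInt [MeasurableSpace ℚ_[p]] [BorelSpace ℚ_[p]]
    (ν : Measure ℚ_[p]) [ν.IsAddHaarMeasure] (h1 : ∀ x, ‖x‖ ≤ 1 → ψ x = 1)
    (hp : ψ (p : ℚ_[p])⁻¹ ≠ 1) :
    IsSummabilityKernel ψ (.mul ℚ_[p] ℚ_[p]) ν ((PadicInt.subring p : Set ℚ_[p]).indicator 1)
      (fun x => ν.real (PadicInt.subring p) * (PadicInt.subring p : Set ℚ_[p]).indicator 1 x) := by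
  have hmeas : MeasurableSet (PadicInt.subring p : Set ℚ_[p]) :=
    isClopen_padicInt.isClosed.measurableSet
  have hcont : Continuous ((PadicInt.subring p : Set ℚ_[p]).indicator (1 : ℚ_[p] → ℝ)) :=
    continuous_one.indicator fun x hx => by simp [isClopen_padicInt.frontier_eq] at hx
  have hint : Integrable ((PadicInt.subring p : Set ℚ_[p]).indicator (1 : ℚ_[p] → ℝ)) ν :=
    (integrable_indicator_iff hmeas).2 (integrableOn_const isCompact_padicInt.measure_lt_top.ne)
  have hpos : 0 < ν.real (PadicInt.subring p : Set ℚ_[p]) :=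
    ENNReal.toReal_pos (isClopen_padicInt.isOpen.measure_pos ν ⟨0, zero_mem _⟩).ne'
      isCompact_padicInt.measure_lt_top.ne
  exact
    { integrable := hint
      norm_le_one := fun ξ => (norm_indicator_le_norm_self _ _).trans (by simp)
      continuousAt_zero := hcont.continuousAt
      apply_zero := by simp [zero_mem]
      continuous_transform := continuous_const.mul hcont
      transform_nonneg := fun x =>
        mul_nonneg hpos.le (Set.indicator_nonneg (fun _ _ => zero_le_one) _)
      integrable_transform := hint.const_mul _
      integral_transform_pos := by
        rw [integral_const_mul, integral_indicator_one hmeas]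
        exact mul_pos hpos hpos
      transform_eq := fun x => by
        rw [Complex.ofReal_mul]
        exact (integral_indicator_mul_padic_addChar ν h1 hp x).symm }

end Padic

/-! ### Solutions of the convolution equation -/

section DualIntegrability

variable {K X : Type u} [NontriviallyNormedField K] [ProperSpace K] [NormedAddCommGroup X]
  [NormedSpace K X] [FiniteDimensional K X] [MeasurableSpace X] [BorelSpace X]
  {ψ : AddChar K Circle} {μ : Measure X} [IsProbabilityMeasure μ]
  {ι : Type*} [Fintype ι] {T : ι → X ≃L[K] X} {i : ι}

lemma integrable_addCharFun_of_eq_prod (hK : HasBoundedLineFreeSubgroups K) (hψ : Continuous ψ)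
    (hψ1 : ψ ≠ 1) (hμ : IsFull K μ)
    (hT : ∀ x, Tendsto (fun n : ℕ => (T i)^[n] x) atTop (𝓝 0))
    (hprod : ∀ ξ, addCharFun ψ μ ξ = ∏ i, addCharFun ψ μ (ξ.comp (T i : X →L[K] X)))
    (ν : Measure (X →L[K] K)) [ν.IsAddHaarMeasure] : Integrable (addCharFun ψ μ) ν := by
  have : ProperSpace (X →L[K] K) := FiniteDimensional.proper K _
  let A (j : ι) : (X →L[K] K) ≃L[K] (X →L[K] K) := (T j).symm.arrowCongr (.refl K K)
  have hA := tendsto_iterate_arrowCongr (F := K) hT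
  have hbounded : Bornology.IsBounded (phaseSubgroup ψ μ : Set (X →L[K] K)) :=
    hK _ (A i) hA _ (isClosed_phaseSubgroup hψ) (fun ξ hξ => comp_mem_phaseSubgroup hprod hξ i)
      fun η => eq_zero_of_forall_smul_mem_phaseSubgroup hψ hψ1 hμ
  exact integrable_of_eq_prod (A := A) (continuous_addCharFun hψ) addCharFun_zero
    norm_addCharFun_le_one (hbounded.subset fun ξ hξ => mem_phaseSubgroup_iff.2 hξ) hA hprod

theorem hasBoundedContinuousDensity_of_addCharFun_eq_prod_of_dual
    (hK : HasBoundedLineFreeSubgroups K) (hψ : Continuous ψ) (hψ1 : ψ ≠ 1)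
    (L : X ≃L[K] (X →L[K] K)) {ν : Measure X} [ν.IsAddHaarMeasure] {G k : X → ℝ}
    (hk : IsSummabilityKernel ψ (L : X →L[K] X →L[K] K) ν G k) (hμ : IsFull K μ)
    (hT : ∀ x, Tendsto (fun n : ℕ => (T i)^[n] x) atTop (𝓝 0))
    (hprod : ∀ ξ, addCharFun ψ μ ξ = ∏ i, addCharFun ψ μ (ξ.comp (T i : X →L[K] X))) :
    HasBoundedContinuousDensity μ ν := by
  have : ProperSpace X := FiniteDimensional.proper K X
  have : ProperSpace (X →L[K] K) := FiniteDimensional.proper K _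
  have := L.isAddHaarMeasure_map ν
  refine hasBoundedContinuousDensity_of_integrable_addCharFun hψ hk ?_
  exact L.toHomeomorph.measurableEmbedding.integrable_map_iff.1
    (integrable_addCharFun_of_eq_prod hK hψ hψ1 hμ hT hprod (ν.map L))

end DualIntegrability

lemma IsFull.map {K V W : Type*} [NontriviallyNormedField K] [CompleteSpace K]
    [AddCommGroup V] [Module K V] [TopologicalSpace V] [MeasurableSpace V] [BorelSpace V]
    [AddCommGroup W] [Module K W] [FiniteDimensional K W] [TopologicalSpace W] [T2Space W]
    [IsTopologicalAddGroup W] [ContinuousSMul K W] [MeasurableSpace W] [BorelSpace W]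
    {μ : Measure V} (hμ : IsFull K μ) (e : V ≃L[K] W) : IsFull K (μ.map e) := by
  intro Z hZ x h
  have hZc : IsClosed (Z : Set W) := Z.closed_of_finiteDimensional
  have hmeas : MeasurableSet {y | y - x ∈ Z}ᶜ :=
    (hZc.preimage (continuous_sub_right x)).measurableSet.compl
  rw [Measure.map_apply e.continuous.measurable hmeas] at h
  refine hμ (Z.comap (e : V →ₗ[K] W)) (fun htop => hZ ?_) (e.symm x) ?_
  · exact Submodule.comap_injective_of_surjective e.surjective htop
  · convert h using 2
    ext y
    simp

lemma subsingleton_of_isFull_dirac {K V : Type*} [Field K] [AddCommGroup V] [Module K V]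
    [MeasurableSpace V] [MeasurableSingletonClass V] {x : V}
    (h : IsFull K (Measure.dirac x)) : Subsingleton V := by
  by_contra hV
  rw [not_subsingleton_iff_nontrivial] at hV
  refine h ⊥ bot_ne_top x ?_
  simp [sub_eq_zero]

lemma HasBoundedContinuousDensity.of_map {V X : Type*} [AddCommGroup V] [TopologicalSpace V]
    [IsTopologicalAddGroup V] [MeasurableSpace V] [BorelSpace V] [AddCommGroup X]
    [TopologicalSpace X] [IsTopologicalAddGroup X] [LocallyCompactSpace X]
    [SecondCountableTopology X] [MeasurableSpace X] [BorelSpace X]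
    (e : V ≃ₜ+ X) {haar μ : Measure V} [haar.IsAddHaarMeasure]
    {ν : Measure X} [ν.IsAddHaarMeasure] (h : HasBoundedContinuousDensity (μ.map e) ν) :
    HasBoundedContinuousDensity μ haar := by
  obtain ⟨-, f, hf0, hf⟩ := h
  have hH : (haar.map e).IsAddHaarMeasure := e.isAddHaarMeasure_map haar
  obtain ⟨c, hc⟩ : ∃ c : NNReal, ν = c • haar.map e :=
    ⟨_, Measure.isAddLeftInvariant_eq_smul ν (haar.map e)⟩
  have he : Measurable e := e.continuous.measurable
  let g : V →ᵇ ℝ := (c : ℝ) • f.compContinuous ⟨e, e.continuous⟩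
  have hg : ∀ x, g x = c * f (e x) := fun _ => rfl
  have heq : μ = haar.withDensity fun x => ENNReal.ofReal (g x) := by
    ext s hs
    have hs' : MeasurableSet (e.symm ⁻¹' s) := e.symm.continuous.measurable hs
    have hpre : e ⁻¹' (e.symm ⁻¹' s) = s := by ext; simp
    calc μ s = μ.map e (e.symm ⁻¹' s) := by rw [Measure.map_apply he hs', hpre]
      _ = c * ∫⁻ x in e.symm ⁻¹' s, ENNReal.ofReal (f x) ∂haar.map e := by
        rw [hf, withDensity_apply _ hs', hc, Measure.restrict_smul, lintegral_smul_measure]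
        rfl
      _ = c * ∫⁻ x in s, ENNReal.ofReal (f (e x)) ∂haar := by
        rw [setLIntegral_map hs' (by fun_prop) he, hpre]
      _ = haar.withDensity (fun x => ENNReal.ofReal (g x)) s := by
        simp_rw [withDensity_apply _ hs, hg, ENNReal.ofReal_mul (NNReal.coe_nonneg c),
          ENNReal.ofReal_coe_nnreal]
        rw [lintegral_const_mul _ (by fun_prop)]
  exact ⟨heq ▸ withDensity_absolutelyContinuous _ _, g,
    fun x => mul_nonneg c.coe_nonneg (hf0 _), heq⟩

lemma exists_toContinuousAddEquiv_eq {K V : Type*} [NontriviallyNormedField K]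
    [AddCommGroup V] [Module K V] [TopologicalSpace V] [T2Space V] [ContinuousSMul K V]
    (hK : DenseRange ((↑) : ℚ → K)) (T : V ≃ₜ+ V) :
    ∃ A : V ≃L[K] V, A.toContinuousAddEquiv = T := by
  refine ⟨{ T with
    map_smul' := fun a x => ?_
    continuous_toFun := T.continuous
    continuous_invFun := T.symm.continuous }, rfl⟩
  exact hK.induction_on (p := fun a : K => T (a • x) = a • T x) a
    (isClosed_eq (T.continuous.comp (by fun_prop)) (by fun_prop)) fun q =>
      map_ratCast_smul T K K q x

lemma eq_convImages_pair {V : Type*} [AddCommGroup V] [TopologicalSpace V] [MeasurableSpace V]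
    [MeasurableAdd₂ V] {μ : Measure V} [SFinite μ] {T S : V ≃ₜ+ V}
    (h : μ = (μ.map T).conv (μ.map S)) : μ = convImages ![T, S] μ := by
  rw [convImages_succ, convImages_succ]
  simpa [convImages] using h

section ChangeOfCoordinates

variable {K : Type u} [NontriviallyNormedField K] [ProperSpace K] [MeasurableSpace K]
  [BorelSpace K] {V : Type*} [AddCommGroup V] [Module K V] [FiniteDimensional K V]
  [TopologicalSpace V] [T2Space V] [IsTopologicalAddGroup V] [ContinuousSMul K V]
  [MeasurableSpace V] [BorelSpace V] {haar μ : Measure V} [haar.IsAddHaarMeasure]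
  [IsProbabilityMeasure μ] {ψ : AddChar K Circle} {ν : Measure K} [ν.IsAddHaarMeasure]
  {G k : K → ℝ}

lemma hasBoundedContinuousDensity_of_addCharFun_eq_prod (hK : HasBoundedLineFreeSubgroups K)
    (hψ : Continuous ψ) (hψ1 : ψ ≠ 1) (hk : IsSummabilityKernel ψ (.mul K K) ν G k)
    (hμ : IsFull K μ) {ι : Type*} [Fintype ι] {A : ι → V ≃L[K] V} {i : ι}
    (hA : ∀ x, Tendsto (fun n : ℕ => (A i)^[n] x) atTop (𝓝 0))
    (hprod : ∀ ξ, addCharFun ψ μ ξ = ∏ i, addCharFun ψ μ (ξ.comp (A i : V →L[K] V))) :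
    HasBoundedContinuousDensity μ haar := by
  have : SecondCountableTopology K := secondCountable_of_proper
  let e : V ≃L[K] (Fin (Module.finrank K V) → K) := (Module.finBasis K V).equivFunL
  let S (j : ι) : (Fin (Module.finrank K V) → K) ≃L[K] (Fin (Module.finrank K V) → K) :=
    (e.symm.trans (A j)).trans e
  have : IsProbabilityMeasure (μ.map e) :=
    Measure.isProbabilityMeasure_map e.continuous.measurable.aemeasurable
  suffices HasBoundedContinuousDensity (μ.map e) (Measure.pi fun _ => ν) from
    .of_map e.toContinuousAddEquiv this
  refine hasBoundedContinuousDensity_of_addCharFun_eq_prod_of_dual hK hψ hψ1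
    (dotProductDual K _) (T := S) (i := i) (hk.pi _) (hμ.map e) (fun x => ?_) fun ξ => ?_
  · have hsemi : Function.Semiconj e (A i) (S i) := fun y => by simp [S]
    refine (((e.continuous.tendsto 0).comp (hA (e.symm x))).congr fun n => ?_).trans (by simp)
    rw [Function.comp_apply, hsemi.iterate_right n, e.apply_symm_apply]
  · have hmap : ∀ η, addCharFun ψ (μ.map e) η = addCharFun ψ μ (η.comp (e : V →L[K] _)) :=
      addCharFun_map hψ e.toContinuousLinearMap
    rw [hmap, hprod]
    refine Finset.prod_congr rfl fun j _ => ?_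
    rw [hmap]
    congr 1
    ext v
    simp [S]

theorem hasBoundedContinuousDensity_of_eq_convImages (hK : HasBoundedLineFreeSubgroups K)
    (hQ : DenseRange ((↑) : ℚ → K)) (hψ : Continuous ψ) (hψ1 : ψ ≠ 1)
    (hk : IsSummabilityKernel ψ (.mul K K) ν G k) (hμ : IsFull K μ) {m : ℕ}
    {T : Fin m → V ≃ₜ+ V} (hT : m ≠ 0 → ∃ i, IsContraction (T i)) (hconv : μ = convImages T μ) :
    HasBoundedContinuousDensity μ haar := by
  have : SecondCountableTopology K := secondCountable_of_proper
  have : SecondCountableTopology V :=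
    (Module.finBasis K V).equivFunL.toHomeomorph.secondCountableTopology
  choose A hA using fun i => exists_toContinuousAddEquiv_eq hQ (T i)
  obtain rfl : (fun i => (A i).toContinuousAddEquiv) = T := funext hA
  have hprod (ξ : V →L[K] K) :
      addCharFun ψ μ ξ = ∏ i, addCharFun ψ μ (ξ.comp (A i : V →L[K] V)) := by
    rw [← addCharFun_convImages hψ, ← hconv]
  obtain rfl | hm := eq_or_ne m 0
  · have hdirac : μ = Measure.dirac 0 := hconv
    have : Subsingleton V := subsingleton_of_isFull_dirac (hdirac ▸ hμ)
    exact hasBoundedContinuousDensity_of_addCharFun_eq_prod hK hψ hψ1 hk hμ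
      (A := fun _ : Unit => .refl K V) (i := ())
      (fun x => by simp [Subsingleton.elim x 0]) fun ξ => by simp
  · obtain ⟨i, hi⟩ := hT hm
    exact hasBoundedContinuousDensity_of_addCharFun_eq_prod hK hψ hψ1 hk hμ (i := i) hi hprod

theorem hasBoundedContinuousDensity_of_eq_conv (hK : HasBoundedLineFreeSubgroups K)
    (hQ : DenseRange ((↑) : ℚ → K)) (hψ : Continuous ψ) (hψ1 : ψ ≠ 1)
    (hk : IsSummabilityKernel ψ (.mul K K) ν G k) (hμ : IsFull K μ) {T S : V ≃ₜ+ V}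
    (hT : IsContraction T) (hconv : μ = (μ.map T).conv (μ.map S)) :
    HasBoundedContinuousDensity μ haar := by
  have : SecondCountableTopology K := secondCountable_of_proper
  have : SecondCountableTopology V :=
    (Module.finBasis K V).equivFunL.toHomeomorph.secondCountableTopology
  exact hasBoundedContinuousDensity_of_eq_convImages hK hQ hψ hψ1 hk hμ (fun _ => ⟨0, hT⟩)
    (eq_convImages_pair hconv)

end ChangeOfCoordinates

theorem theorem5p3_general :
    (∀ (V : Type*) [AddCommGroup V] [Module ℝ V] [FiniteDimensional ℝ V]
        [TopologicalSpace V] [T2Space V] [IsTopologicalAddGroup V] [ContinuousSMul ℝ V]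
        [MeasurableSpace V] [BorelSpace V]
        (haar : Measure V) [haar.IsAddHaarMeasure]
        (μ : Measure V) [IsProbabilityMeasure μ], IsFull ℝ μ →
      (∀ (m : ℕ) (T : Fin m → V ≃ₜ+ V), (m ≠ 0 → ∃ i, IsContraction (T i)) →
        μ = convImages T μ → HasBoundedContinuousDensity μ haar) ∧
      (∀ T S : V ≃ₜ+ V, IsContraction T → μ = (μ.map T).conv (μ.map S) →
        HasBoundedContinuousDensity μ haar)) ∧
    (∀ (p : ℕ) [Fact p.Prime]
        (V : Type*) [AddCommGroup V] [Module ℚ_[p] V] [FiniteDimensional ℚ_[p] V]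
        [TopologicalSpace V] [T2Space V] [IsTopologicalAddGroup V] [ContinuousSMul ℚ_[p] V]
        [MeasurableSpace V] [BorelSpace V]
        (haar : Measure V) [haar.IsAddHaarMeasure]
        (μ : Measure V) [IsProbabilityMeasure μ], IsFull ℚ_[p] μ →
      (∀ (m : ℕ) (T : Fin m → V ≃ₜ+ V), (m ≠ 0 → ∃ i, IsContraction (T i)) →
        μ = convImages T μ → HasBoundedContinuousDensity μ haar) ∧
      (∀ T S : V ≃ₜ+ V, IsContraction T → μ = (μ.map T).conv (μ.map S) →
        HasBoundedContinuousDensity μ haar)) := by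
  refine ⟨fun V _ _ _ _ _ _ _ _ _ haar _ μ _ hμ => ?_,
    fun p _ V _ _ _ _ _ _ _ _ _ haar _ μ _ hμ => ?_⟩
  · have hψ := Real.continuous_fourierChar
    have hk := isSummabilityKernel_gaussian
    exact ⟨fun m T => hasBoundedContinuousDensity_of_eq_convImages
        hasBoundedLineFreeSubgroups_real Rat.denseRange_cast hψ fourierChar_ne_one hk hμ,
      fun T S => hasBoundedContinuousDensity_of_eq_conv
        hasBoundedLineFreeSubgroups_real Rat.denseRange_cast hψ fourierChar_ne_one hk hμ⟩
  · borelize ℚ_[p]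
    obtain ⟨ψ, hψint, hψp⟩ := exists_padic_addChar p
    have hψ := continuous_padic_addChar hψint
    have hψ1 : ψ ≠ 1 := fun h => hψp (AddChar.eq_one_iff.1 h _)
    have hk := isSummabilityKernel_padicInt Measure.addHaar hψint hψp
    exact ⟨fun m T => hasBoundedContinuousDensity_of_eq_convImages
        hasBoundedLineFreeSubgroups_padic (Padic.denseRange_ratCast p) hψ hψ1 hk hμ,
      fun T S => hasBoundedContinuousDensity_of_eq_conv
        hasBoundedLineFreeSubgroups_padic (Padic.denseRange_ratCast p) hψ hψ1 hk hμ⟩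

theorem theorem5p3 :
    -- real vector spaces
    (∀ (V : Type*) [AddCommGroup V] [Module ℝ V] [FiniteDimensional ℝ V]
        [TopologicalSpace V] [T2Space V] [IsTopologicalAddGroup V] [ContinuousSMul ℝ V]
        [MeasurableSpace V] [BorelSpace V]
        (haar : Measure V) [haar.IsAddHaarMeasure]
        (μ : Measure V) [IsProbabilityMeasure μ], IsFull ℝ μ →
      (∀ (m : ℕ) (T : Fin m → V ≃ₜ+ V), (∀ i, IsContraction (T i)) →
        (∀ i j, Function.Commute (T i) (T j)) → μ = convImages T μ →
          HasBoundedContinuousDensity μ haar) ∧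
      (IsAutophage μ → HasBoundedContinuousDensity μ haar)) ∧
    -- `p`-adic vector spaces
    (∀ (p : ℕ) [Fact p.Prime]
        (V : Type*) [AddCommGroup V] [Module ℚ_[p] V] [FiniteDimensional ℚ_[p] V]
        [TopologicalSpace V] [T2Space V] [IsTopologicalAddGroup V] [ContinuousSMul ℚ_[p] V]
        [MeasurableSpace V] [BorelSpace V]
        (haar : Measure V) [haar.IsAddHaarMeasure]
        (μ : Measure V) [IsProbabilityMeasure μ], IsFull ℚ_[p] μ →
      (∀ (m : ℕ) (T : Fin m → V ≃ₜ+ V), (∀ i, IsContraction (T i)) →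
        (∀ i j, Function.Commute (T i) (T j)) → μ = convImages T μ →
          HasBoundedContinuousDensity μ haar) ∧
      (IsAutophage μ → HasBoundedContinuousDensity μ haar)) := by
  refine theorem5p3_general.imp
    (fun h V _ _ _ _ _ _ _ _ _ haar _ μ _ hμ => (h V haar μ hμ).imp ?_ ?_)
    fun h p _ V _ _ _ _ _ _ _ _ _ haar _ μ _ hμ => (h p V haar μ hμ).imp ?_ ?_
  · exact fun h m T hT _ => h m T fun hm => ⟨⟨0, Nat.pos_of_ne_zero hm⟩, hT _⟩
  · exact fun h ⟨T, S, hT, _, _, hμ⟩ => h T S hT hμ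
  · exact fun h m T hT _ => h m T fun hm => ⟨⟨0, Nat.pos_of_ne_zero hm⟩, hT _⟩
  · exact fun h ⟨T, S, hT, _, _, hμ⟩ => h T S hT hμ
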